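/- Let $N\in\mathbb N$, $k>0$, and let $\sigma\in C^{\infty}(\mathbb{R}^{N}\setminus\{0\};(0,\infty))$ be homogeneous of degree $k$, i.e. $\sigma(t\xi)=t^{k}\sigma(\xi)$ for all $t>0$, $\xi\neq 0$. Let $1<\alpha<2$ and $0\le\delta<k$, and let $$E_{\alpha,1}(z)=\sum_{n=0}^{\infty}\frac{z^{n}}{\Gamma(\alpha n+1)},\qquad z\in\mathbb C,$$ be the Mittag-Leffler function. Then $\xi\mapsto|\xi|^{\delta}E_{\alpha,1}(-\sigma(\xi))$ is $C^\infty$ on $\mathbb{R}^{N}\setminus\{0\}$, and there exists a constant $C>0$, depending only on $N,\sigma,k,\alpha,\delta$, such that the following holds. If $A\in\mathbb R$ satisfies $$\left|\frac{\partial^{\gamma}}{\partial\xi^{\gamma}}\sigma(\xi)\right|\le A|\xi|^{k-|\gamma|}\qquad\text{for all }\xi\ne0$$ and all multi-indices $\gamma\in(\mathbb N\cup\{0\})^N$ with $|\gamma|\le[N/2]+1$, then $$\left|\frac{\partial^{\gamma}}{\partial\xi^{\gamma}}\Big[|\xi|^{\delta}E_{\alpha,1}(-\sigma(\xi))\Big]\right|\le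 C A\,|\xi|^{-|\gamma|}\qquad\text{for all }\xi\ne0$$ and all multi-indices $\gamma$ with $|\gamma|\le[N/2]+1$. -/

import Mathlib

open scoped ContDiff

/-- The two-parametric Mittag-Leffler function
`E_{α,β}(z) = ∑_{n ≥ 0} z ^ n / Γ(α n + β)` (the series converges for all `z` when `α, β > 0`). -/
noncomputable def mittagLeffler (α β : ℝ) (z : ℂ) : ℂ :=
  ∑' n : ℕ, z ^ n / (Real.Gamma (α * n + β) : ℂ)

/-- The partial derivative `∂f/∂ξ_i` of a function on `ℝ^N`. -/
noncomputable def partialDeriv {N : ℕ} {F : Type*} [NormedAddCommGroup F] [NormedSpace ℝ F]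
    (i : Fin N) (f : EuclideanSpace ℝ (Fin N) → F) : EuclideanSpace ℝ (Fin N) → F :=
  fun ξ => lineDeriv ℝ f ξ (EuclideanSpace.single i 1)

/-- The partial derivative `∂^γ f = ∂_0^{γ_0} ∂_1^{γ_1} ⋯ ∂_{N-1}^{γ_{N-1}} f` for a
multi-index `γ`. -/
noncomputable def multiDeriv {N : ℕ} {F : Type*} [NormedAddCommGroup F] [NormedSpace ℝ F]
    (γ : Fin N → ℕ) (f : EuclideanSpace ℝ (Fin N) → F) : EuclideanSpace ℝ (Fin N) → F :=
  (List.finRange N).foldr (fun i g => (partialDeriv i)^[γ i] g) f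

/-!
Fourier inversion of the Gamma density gives Hankel's formula
`2π / Γ(s) = ∫ e^(1+iy) (1+iy)^(-s) dy`. Summing a geometric series turns it into an integral
representation of `E_{α,β}` on the unit disc. As `α < 2`, the curve `(1+iy)^α` stays away from a
cone around the negative real axis, so the representation continues to that cone, where it yields
`E_{α,β}(z) = O(1/(1+|z|))` once `β > α + 1`. The recurrence
`E_{α,β} = β E_{α,β+1} + α z E'_{α,β+1}` and Cauchy's estimates on slightly smaller cones bring this
decay down to every `β > 0` and extend it to all `z^j E^(j)(z)`.

A smooth homogeneous function of degree `k` is a symbol of order `k`, and by the Leibniz and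
Faà di Bruno formulas symbols are stable under products and under composition with a profile `g`
such that `s^i g^(i)(s) = O(s^m)`. The case `m = -δ/k ∈ [-1, 0]` makes `|ξ|^δ E_{α,1}(-σ(ξ))` a
symbol of order `0`. The constant `A` is bounded below because `σ` is positive at some point.
-/

open Complex MeasureTheory ProbabilityTheory Set Filter Topology

section GammaDistribution

variable {a r : ℝ}

theorem gammaPDFReal_mul_exp {t : ℝ} (hr : 0 < r) (ht : t < r) (x : ℝ) :
    gammaPDFReal a r x * Real.exp (t * x) = (1 - t / r) ^ (-a) * gammaPDFReal a (r - t) x := by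
  have hrate : (1 - t / r) ^ (-a) * (r - t) ^ a = r ^ a := by
    have hrt : 0 < r - t := sub_pos.2 ht
    rw [one_sub_div hr.ne', Real.rpow_neg (by positivity), Real.div_rpow hrt.le hr.le]
    field_simp
  simp only [gammaPDFReal]
  split_ifs
  · rw [← hrate, show -((r - t) * x) = -(r * x) + t * x by ring, Real.exp_add]
    ring
  · simp

theorem toReal_gammaPDF (ha : 0 < a) (hr : 0 < r) (x : ℝ) :
    (gammaPDF a r x).toReal = gammaPDFReal a r x :=
  ENNReal.toReal_ofReal (gammaPDFReal_nonneg ha hr x)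

theorem measurable_gammaPDF : Measurable (gammaPDF a r) :=
  (measurable_gammaPDFReal a r).ennreal_ofReal

theorem gammaPDF_lt_top (x : ℝ) : gammaPDF a r x < ⊤ := ENNReal.ofReal_lt_top

theorem integral_gammaMeasure {F : Type*} [NormedAddCommGroup F] [NormedSpace ℝ F]
    (ha : 0 < a) (hr : 0 < r) (f : ℝ → F) :
    ∫ x, f x ∂gammaMeasure a r = ∫ x, gammaPDFReal a r x • f x := by
  rw [gammaMeasure, integral_withDensity_eq_integral_toReal_smul measurable_gammaPDF
    (ae_of_all _ gammaPDF_lt_top)]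
  simp only [toReal_gammaPDF ha hr]

theorem integrable_gammaMeasure_iff {F : Type*} [NormedAddCommGroup F] [NormedSpace ℝ F]
    (ha : 0 < a) (hr : 0 < r) {f : ℝ → F} :
    Integrable f (gammaMeasure a r) ↔ Integrable fun x => gammaPDFReal a r x • f x := by
  rw [gammaMeasure, integrable_withDensity_iff_integrable_smul' measurable_gammaPDF
    (ae_of_all _ gammaPDF_lt_top)]
  simp only [toReal_gammaPDF ha hr]

theorem integrable_gammaPDFReal (ha : 0 < a) (hr : 0 < r) : Integrable (gammaPDFReal a r) := by
  have := isProbabilityMeasure_gammaMeasure ha hr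
  simpa using (integrable_gammaMeasure_iff ha hr).1 (integrable_const (1 : ℝ))

theorem integral_gammaPDFReal (ha : 0 < a) (hr : 0 < r) : ∫ x, gammaPDFReal a r x = 1 := by
  have := isProbabilityMeasure_gammaMeasure ha hr
  simpa using (integral_gammaMeasure ha hr fun _ => (1 : ℝ)).symm

theorem Iio_subset_integrableExpSet_gammaMeasure (ha : 0 < a) (hr : 0 < r) :
    Iio r ⊆ integrableExpSet id (gammaMeasure a r) := fun t ht => by
  simp only [integrableExpSet, mem_ofPred_eq, id, integrable_gammaMeasure_iff ha hr, smul_eq_mul,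
    gammaPDFReal_mul_exp hr ht]
  exact (integrable_gammaPDFReal ha (sub_pos.2 ht)).const_mul _

theorem mgf_gammaMeasure (ha : 0 < a) (hr : 0 < r) {t : ℝ} (ht : t < r) :
    mgf id (gammaMeasure a r) t = (1 - t / r) ^ (-a) := by
  simp only [mgf, id, integral_gammaMeasure ha hr, smul_eq_mul, gammaPDFReal_mul_exp hr ht,
    integral_const_mul, integral_gammaPDFReal ha (sub_pos.2 ht), mul_one]

theorem frequently_nhdsNE_ofReal {p : ℂ → Prop} {x : ℝ} (h : ∀ᶠ t : ℝ in 𝓝 x, p t) :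
    ∃ᶠ z in 𝓝[≠] (x : ℂ), p z := by
  have hlim : Tendsto ofReal (𝓝[≠] x) (𝓝[≠] (x : ℂ)) :=
    continuous_ofReal.continuousWithinAt.tendsto_nhdsWithin fun t ht => by simpa using ht
  exact hlim.frequently (h.filter_mono nhdsWithin_le_nhds).frequently

theorem complexMGF_gammaMeasure (ha : 0 < a) (hr : 0 < r) {z : ℂ} (hz : z.re < r) :
    complexMGF id (gammaMeasure a r) z = (1 - z / r) ^ (-a : ℂ) := by
  have hopen : IsOpen {z : ℂ | z.re < r} := isOpen_lt continuous_re continuous_const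
  have hmgf : AnalyticOnNhd ℂ (complexMGF id (gammaMeasure a r)) {z | z.re < r} :=
    analyticOnNhd_complexMGF.mono fun z hz => interior_maximal
      (Iio_subset_integrableExpSet_gammaMeasure ha hr) isOpen_Iio hz
  have hpow : AnalyticOnNhd ℂ (fun z : ℂ => (1 - z / r) ^ (-a : ℂ)) {z | z.re < r} := by
    refine DifferentiableOn.analyticOnNhd (fun z hz => ?_) hopen
    have hslit : 1 - z / r ∈ slitPlane := Or.inl (by simpa [div_lt_one hr] using hz)
    exact ((by fun_prop : DifferentiableAt ℂ (fun z : ℂ => 1 - z / r) z).cpow_const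
      hslit).differentiableWithinAt
  refine hmgf.eqOn_of_preconnected_of_frequently_eq hpow (convex_halfSpace_re_lt r).isPreconnected
    (z₀ := ((0 : ℝ) : ℂ)) (by simpa using hr) (frequently_nhdsNE_ofReal ?_) hz
  filter_upwards [Iio_mem_nhds hr] with t (ht : t < r)
  rw [complexMGF_ofReal, mgf_gammaMeasure ha hr ht,
    ofReal_cpow (sub_nonneg.2 ((div_le_one hr).2 ht.le))]
  push_cast
  rfl

theorem fourier_gammaPDFReal (ha : 0 < a) (hr : 0 < r) (w : ℝ) :
    FourierTransform.fourier (fun x => (gammaPDFReal a r x : ℂ)) w =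
      (1 + (2 * Real.pi * w / r : ℝ) * I) ^ (-a : ℂ) := by
  have hmgf := complexMGF_gammaMeasure ha hr (z := -(2 * Real.pi * w : ℝ) * I) (by simpa using hr)
  rw [complexMGF, integral_gammaMeasure ha hr] at hmgf
  rw [Real.fourier_real_eq_integral_exp_smul]
  convert! hmgf using 2
  · ext x
    rw [real_smul, smul_eq_mul, mul_comm]
    simp only [id]
    push_cast
    ring_nf
  · push_cast
    ring

end GammaDistribution

section VerticalLine

theorem one_add_mul_I_mem_slitPlane (y : ℝ) : (1 + y * I : ℂ) ∈ slitPlane := Or.inl (by simp)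

theorem one_le_norm_one_add_mul_I (y : ℝ) : 1 ≤ ‖(1 + y * I : ℂ)‖ := by
  simpa using abs_re_le_norm (1 + y * I : ℂ)

theorem continuous_one_add_mul_I_cpow (s : ℂ) : Continuous fun y : ℝ => (1 + y * I : ℂ) ^ s :=
  Continuous.cpow (by fun_prop) continuous_const one_add_mul_I_mem_slitPlane

theorem integrable_one_add_mul_I_cpow {s : ℝ} (hs : 1 < s) :
    Integrable fun y : ℝ => (1 + y * I : ℂ) ^ (-s : ℂ) := by
  refine (integrable_rpow_neg_one_add_norm_sq (E := ℝ) (r := s) (by simpa)).mono'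
    (continuous_one_add_mul_I_cpow _).aestronglyMeasurable (ae_of_all _ fun y => le_of_eq ?_)
  rw [← ofReal_neg, norm_cpow_real, ← ofReal_one, norm_add_mul_I, Real.sqrt_eq_rpow,
    ← Real.rpow_mul (by positivity), Real.norm_eq_abs, sq_abs]
  congr 1 <;> ring

theorem gammaPDFReal_one_one (s : ℝ) : gammaPDFReal s 1 1 = Real.exp (-1) / Real.Gamma s := by
  simp [gammaPDFReal, div_eq_inv_mul]

theorem continuousAt_gammaPDFReal {a r x : ℝ} (hx : 0 < x) :
    ContinuousAt (gammaPDFReal a r) x := by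
  have hformula : ContinuousAt
      (fun x => r ^ a / Real.Gamma a * x ^ (a - 1) * Real.exp (-(r * x))) x :=
    (continuousAt_const.mul (Real.continuousAt_rpow_const _ _ (Or.inl hx.ne'))).mul (by fun_prop)
  refine hformula.congr ?_
  filter_upwards [Ioi_mem_nhds hx] with y hy
  rw [gammaPDFReal, if_pos (le_of_lt hy)]

theorem integral_exp_mul_I_mul_one_add_mul_I_cpow {s : ℝ} (hs : 1 < s) :
    ∫ y : ℝ, cexp (y * I) * (1 + y * I) ^ (-s : ℂ) =
      2 * Real.pi * (Real.exp (-1) / Real.Gamma s : ℝ) := by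
  have hs₀ : 0 < s := one_pos.trans hs
  have hfourier : FourierTransform.fourier (fun x => (gammaPDFReal s 1 x : ℂ)) =
      fun w : ℝ => (1 + (2 * Real.pi * w : ℝ) * I) ^ (-s : ℂ) := by
    ext w
    simpa using fourier_gammaPDFReal hs₀ one_pos w
  have hfourier_int : Integrable (FourierTransform.fourier fun x => (gammaPDFReal s 1 x : ℂ)) :=
    hfourier ▸ (integrable_one_add_mul_I_cpow hs).comp_mul_left' (by positivity)
  have hinversion := (integrable_gammaPDFReal hs₀ one_pos).ofReal (𝕜 := ℂ)
    |>.fourierInv_fourier_eq (v := 1) hfourier_int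
      (continuous_ofReal.continuousAt.comp (continuousAt_gammaPDFReal one_pos))
  rw [RCLike.ofReal_eq_complex_ofReal, hfourier, Real.fourierInv_eq', gammaPDFReal_one_one]
    at hinversion
  have hscale := Measure.integral_comp_mul_left
    (fun y : ℝ => cexp (y * I) * (1 + y * I) ^ (-s : ℂ)) (2 * Real.pi)
  simp only [RCLike.inner_apply, conj_trivial, one_mul, smul_eq_mul] at hinversion
  rw [hinversion, abs_of_pos (by positivity), eq_inv_smul_iff₀ (by positivity)] at hscale
  rw [← hscale, real_smul]
  push_cast
  rfl

theorem integral_exp_mul_one_add_mul_I_cpow {s : ℝ} (hs : 1 < s) :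
    ∫ y : ℝ, cexp (1 + y * I) * (1 + y * I) ^ (-s : ℂ) = 2 * Real.pi / Real.Gamma s := by
  simp only [Complex.exp_add, mul_assoc, integral_const_mul,
    integral_exp_mul_I_mul_one_add_mul_I_cpow hs]
  rw [Real.exp_neg]
  push_cast
  field_simp [Complex.exp_ne_zero]

end VerticalLine

section GeometricIntegral

variable {Ω : Type*} [MeasurableSpace Ω] {μ : Measure Ω} {p q : Ω → ℂ}

theorem hasSum_integral_mul_pow (hp : Integrable p μ) (hq : AEStronglyMeasurable q μ)
    (hq_le : ∀ y, ‖q y‖ ≤ 1) {z : ℂ} (hz : ‖z‖ < 1) :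
    HasSum (fun n => z ^ n * ∫ y, p y * q y ^ n ∂μ) (∫ y, p y / (1 - z * q y) ∂μ) := by
  have hterm_le (n : ℕ) (y : Ω) : ‖p y * (z * q y) ^ n‖ ≤ ‖z‖ ^ n * ‖p y‖ := by
    rw [norm_mul, norm_pow, norm_mul, mul_comm]
    gcongr
    exact mul_le_of_le_one_right (norm_nonneg z) (hq_le y)
  have hterm_int (n : ℕ) : Integrable (fun y => p y * (z * q y) ^ n) μ :=
    (hp.norm.const_mul _).mono' (hp.1.mul ((hq.const_mul z).pow n)) (ae_of_all _ (hterm_le n))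
  have hsummable : Summable fun n => ∫ y, ‖p y * (z * q y) ^ n‖ ∂μ := by
    refine .of_nonneg_of_le (fun n => integral_nonneg fun y => norm_nonneg _) (fun n => ?_)
      ((summable_geometric_of_lt_one (norm_nonneg z) hz).mul_right (∫ y, ‖p y‖ ∂μ))
    rw [← integral_const_mul]
    exact integral_mono (hterm_int n).norm (hp.norm.const_mul _) (hterm_le n)
  convert! hasSum_integral_of_summable_integral_norm hterm_int hsummable using 1
  · ext n
    rw [← integral_const_mul]
    congr with y
    ring
  · congr with y
    have hzq : ‖z * q y‖ < 1 := by
      rw [norm_mul]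
      exact (mul_le_of_le_one_right (norm_nonneg z) (hq_le y)).trans_lt hz
    rw [tsum_mul_left, tsum_geometric_of_norm_lt_one hzq, div_eq_mul_inv]

theorem hasDerivAt_div_one_sub_mul {c w z : ℂ} (h : 1 - z * w ≠ 0) :
    HasDerivAt (fun z => c / (1 - z * w)) (c * w / (1 - z * w) ^ 2) z := by
  have hden : HasDerivAt (fun z => 1 - z * w) (-w) z := by
    simpa using ((hasDerivAt_id z).mul_const w).const_sub 1
  convert! hden.inv h |>.const_mul c using 1
  ring

theorem differentiableOn_integral_div_one_sub_mul (hp : Integrable p μ)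
    (hq : AEStronglyMeasurable q μ) (hq_le : ∀ y, ‖q y‖ ≤ 1) {U : Set ℂ} (hU : IsOpen U) {c : ℝ}
    (hc : 0 < c) (hUc : ∀ z ∈ U, ∀ y, c ≤ ‖1 - z * q y‖) :
    DifferentiableOn ℂ (fun z => ∫ y, p y / (1 - z * q y) ∂μ) U := by
  intro z hz
  have hden (z : ℂ) : AEMeasurable (fun y => 1 - z * q y) μ :=
    (hq.aemeasurable.const_mul z).const_sub 1
  have hmeas (z : ℂ) : AEStronglyMeasurable (fun y => p y / (1 - z * q y)) μ :=
    (hp.1.aemeasurable.div (hden z)).aestronglyMeasurable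
  refine (hasDerivAt_integral_of_dominated_loc_of_deriv_le (𝕜 := ℂ)
    (F' := fun z y => p y * q y / (1 - z * q y) ^ 2) (bound := fun y => ‖p y‖ / c ^ 2)
    (hU.mem_nhds hz) (.of_forall hmeas) ?_ ?_ ?_ (hp.norm.div_const _)
    ?_).2.differentiableAt.differentiableWithinAt
  · refine (hp.norm.div_const c).mono' (hmeas z) (ae_of_all _ fun y => ?_)
    rw [norm_div]
    gcongr
    exact hUc z hz y
  · exact ((hp.1.aemeasurable.mul hq.aemeasurable).div ((hden z).pow_const 2)).aestronglyMeasurable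
  · refine ae_of_all _ fun y w hw => ?_
    rw [norm_div, norm_mul, norm_pow]
    gcongr
    · exact mul_le_of_le_one_right (norm_nonneg _) (hq_le y)
    · exact hUc w hw y
  · exact ae_of_all _ fun y w hw => hasDerivAt_div_one_sub_mul
      (norm_pos_iff.1 (hc.trans_le (hUc w hw y)))

theorem norm_integral_div_one_sub_mul_le (hpq : Integrable (fun y => p y / q y) μ)
    (hq_ne : ∀ y, q y ≠ 0) (hq_le : ∀ y, ‖q y‖ ≤ 1) {c : ℝ} (hc : 0 < c) {z : ℂ}
    (hzc : ∀ y, c * (1 + ‖z * q y‖) ≤ ‖1 - z * q y‖) :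
    ‖∫ y, p y / (1 - z * q y) ∂μ‖ ≤ (∫ y, ‖p y / q y‖ ∂μ) / c * (1 + ‖z‖)⁻¹ := by
  rw [div_mul_eq_mul_div, ← integral_mul_const, ← integral_div]
  refine norm_integral_le_of_norm_le ((hpq.norm.mul_const _).div_const _) (ae_of_all _ fun y => ?_)
  have hq_pos : 0 < ‖q y‖ := norm_pos_iff.2 (hq_ne y)
  have hden : ‖q y‖ * c * (1 + ‖z‖) ≤ ‖1 - z * q y‖ := by
    refine le_trans ?_ (hzc y)
    rw [norm_mul]
    nlinarith [hq_le y]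
  rw [norm_div, norm_div]
  calc ‖p y‖ / ‖1 - z * q y‖ ≤ ‖p y‖ / (‖q y‖ * c * (1 + ‖z‖)) := by gcongr
    _ = ‖p y‖ / ‖q y‖ * (1 + ‖z‖)⁻¹ / c := by field_simp

end GeometricIntegral

section MittagLeffler

theorem rpow_mul_exp_neg_le_Gamma_add_one {s R : ℝ} (hs : 0 ≤ s) (hR : 0 ≤ R) :
    R ^ s * Real.exp (-R) ≤ Real.Gamma (s + 1) := by
  have hintegrable := Real.GammaIntegral_convergent (s := s + 1) (by linarith)
  rw [Real.Gamma_eq_integral (by linarith)]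
  rw [add_sub_cancel_right] at hintegrable ⊢
  calc R ^ s * Real.exp (-R) = ∫ x in Ioi R, Real.exp (-x) * R ^ s := by
        rw [integral_mul_const, integral_exp_neg_Ioi, mul_comm]
    _ ≤ ∫ x in Ioi R, Real.exp (-x) * x ^ s := by
        refine setIntegral_mono_on ((integrableOn_exp_neg_Ioi R).mul_const _)
          (hintegrable.mono_set (Ioi_subset_Ioi hR)) measurableSet_Ioi fun x hx => ?_
        gcongr
        exact le_of_lt hx
    _ ≤ ∫ x in Ioi 0, Real.exp (-x) * x ^ s := by
        refine setIntegral_mono_set hintegrable ?_ (Ioi_subset_Ioi hR).eventuallyLE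
        filter_upwards [ae_restrict_mem measurableSet_Ioi] with x (hx : 0 < x)
        positivity

theorem inv_Gamma_le {s R : ℝ} (hs : 0 < s) (hR : 0 < R) :
    (Real.Gamma s)⁻¹ ≤ s * (Real.exp R * R ^ (-s)) := by
  rw [inv_le_iff_one_le_mul₀ (Real.Gamma_pos_of_pos hs)]
  calc 1 = Real.exp R * R ^ (-s) * (R ^ s * Real.exp (-R)) := by
        rw [Real.exp_neg, Real.rpow_neg hR.le]
        field_simp
    _ ≤ Real.exp R * R ^ (-s) * Real.Gamma (s + 1) := by
        gcongr
        exact rpow_mul_exp_neg_le_Gamma_add_one hs.le hR.le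
    _ = s * (Real.exp R * R ^ (-s)) * Real.Gamma s := by rw [Real.Gamma_add_one hs.ne']; ring

variable {α β : ℝ}

theorem summable_pow_div_Gamma (hα : 0 < α) (hβ : 0 < β) {r : ℝ} (hr : 0 ≤ r) :
    Summable fun n : ℕ => r ^ n / Real.Gamma (α * n + β) := by
  obtain ⟨R, hrR, hR⟩ : ∃ R : ℝ, r < R ^ α ∧ 0 < R :=
    ((tendsto_rpow_atTop hα).eventually_gt_atTop r |>.and (eventually_gt_atTop 0)).exists
  have hratio : ‖r / R ^ α‖ < 1 := by
    rwa [Real.norm_of_nonneg (by positivity), div_lt_one (by positivity)]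
  have hlinear : Summable fun n : ℕ => (α * n + β) * (r / R ^ α) ^ n := by
    have h₀ := (summable_geometric_of_norm_lt_one hratio).mul_left β
    have h₁ := (summable_pow_mul_geometric_of_norm_lt_one 1 hratio).mul_left α
    exact (h₁.add h₀).congr fun n => by ring
  refine .of_nonneg_of_le (fun n => by positivity) (fun n => ?_)
    (hlinear.mul_left (Real.exp R * R ^ (-β)))
  calc r ^ n / Real.Gamma (α * n + β)
      ≤ r ^ n * ((α * n + β) * (Real.exp R * R ^ (-(α * n + β)))) := by
        rw [div_eq_mul_inv]
        gcongr
        exact inv_Gamma_le (by positivity) hR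
    _ = Real.exp R * R ^ (-β) * ((α * n + β) * (r / R ^ α) ^ n) := by
        rw [neg_add, Real.rpow_add hR, Real.rpow_neg hR.le (α * n), Real.rpow_mul hR.le,
          Real.rpow_natCast, div_pow]
        ring

theorem norm_pow_div_Gamma_le (hα : 0 ≤ α) (hβ : 0 < β) {z : ℂ} {r : ℝ} (hz : ‖z‖ ≤ r) (n : ℕ) :
    ‖z ^ n / (Real.Gamma (α * n + β) : ℂ)‖ ≤ r ^ n / Real.Gamma (α * n + β) := by
  have hΓ : 0 < Real.Gamma (α * n + β) := Real.Gamma_pos_of_pos (by positivity)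
  rw [norm_div, norm_pow, norm_real, Real.norm_of_nonneg hΓ.le]
  gcongr

theorem hasSum_mittagLeffler (hα : 0 < α) (hβ : 0 < β) (z : ℂ) :
    HasSum (fun n : ℕ => z ^ n / (Real.Gamma (α * n + β) : ℂ)) (mittagLeffler α β z) :=
  (Summable.of_norm_bounded (summable_pow_div_Gamma hα hβ (norm_nonneg z))
    (norm_pow_div_Gamma_le hα.le hβ le_rfl)).hasSum

theorem differentiable_mittagLeffler (hα : 0 < α) (hβ : 0 < β) :
    Differentiable ℂ (mittagLeffler α β) := by
  intro z
  have hball : DifferentiableOn ℂ (mittagLeffler α β) (Metric.ball 0 (‖z‖ + 1)) :=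
    Complex.differentiableOn_tsum_of_summable_norm
      (summable_pow_div_Gamma hα hβ (by positivity)) (fun n => by fun_prop) Metric.isOpen_ball
      fun n w hw => norm_pow_div_Gamma_le hα.le hβ (mem_ball_zero_iff.1 hw).le n
  exact hball.differentiableAt (Metric.isOpen_ball.mem_nhds (by simp))

theorem hasSum_deriv_mittagLeffler (hα : 0 < α) (hβ : 0 < β) (z : ℂ) :
    HasSum (fun n : ℕ => n * z ^ (n - 1) / (Real.Gamma (α * n + β) : ℂ))
      (deriv (mittagLeffler α β) z) := by
  have hderiv := Complex.hasSum_deriv_of_summable_norm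
    (summable_pow_div_Gamma hα hβ (r := ‖z‖ + 1) (by positivity)) (fun n => by fun_prop)
    Metric.isOpen_ball (fun n w hw => norm_pow_div_Gamma_le hα.le hβ (mem_ball_zero_iff.1 hw).le n)
    (z := z) (by simp)
  simp only [deriv_div_const, deriv_pow_field] at hderiv
  exact hderiv

theorem mittagLeffler_eq_add_mul_deriv (hα : 0 < α) (hβ : 0 < β) (z : ℂ) :
    mittagLeffler α β z =
      β * mittagLeffler α (β + 1) z + α * (z * deriv (mittagLeffler α (β + 1)) z) := by
  have hβ₁ : 0 < β + 1 := by positivity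
  refine (hasSum_mittagLeffler hα hβ z).unique ?_
  refine (((hasSum_mittagLeffler hα hβ₁ z).mul_left (β : ℂ)).add
    (((hasSum_deriv_mittagLeffler hα hβ₁ z).mul_left z).mul_left (α : ℂ))).congr_fun fun n => ?_
  have hs : 0 < α * n + β := by positivity
  have hsℂ : (α * n + β : ℂ) ≠ 0 := by exact_mod_cast hs.ne'
  have hpow : (n : ℂ) * z ^ n = z * (n * z ^ (n - 1)) := by cases n <;> simp [pow_succ]; ring
  have hΓ : (Real.Gamma (α * n + β) : ℂ) ≠ 0 := ofReal_ne_zero.2 (Real.Gamma_pos_of_pos hs).ne'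
  rw [← add_assoc, Real.Gamma_add_one hs.ne']
  push_cast
  field_simp
  linear_combination (α : ℂ) * hpow

/-- The Bromwich integral `-i ∫ e^ζ ζ^(-β) / (1 - z ζ^(-α)) dζ` along the line `Re ζ = 1`,
parametrized by `ζ = 1 + iy`. It represents `2π E_{α,β}(z)` away from the image of that line
under `ζ ↦ ζ^α`. -/
noncomputable def bromwichIntegral (α β : ℝ) (z : ℂ) : ℂ :=
  ∫ y : ℝ, cexp (1 + y * I) * (1 + y * I) ^ (-β : ℂ) / (1 - z * (1 + y * I) ^ (-α : ℂ))

theorem one_add_mul_I_cpow_mul_cpow (y : ℝ) (s t : ℂ) :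
    (1 + y * I : ℂ) ^ s * (1 + y * I) ^ t = (1 + y * I) ^ (s + t) :=
  (cpow_add _ _ (slitPlane_ne_zero (one_add_mul_I_mem_slitPlane y))).symm

theorem one_add_mul_I_cpow_ne_zero (y : ℝ) (s : ℂ) : (1 + y * I : ℂ) ^ s ≠ 0 := by
  simp [cpow_eq_zero_iff, slitPlane_ne_zero (one_add_mul_I_mem_slitPlane y)]

theorem norm_one_add_mul_I_cpow_neg_le_one (hα : 0 ≤ α) (y : ℝ) :
    ‖(1 + y * I : ℂ) ^ (-α : ℂ)‖ ≤ 1 := by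
  rw [← ofReal_neg, norm_cpow_real]
  exact Real.rpow_le_one_of_one_le_of_nonpos (one_le_norm_one_add_mul_I y) (neg_nonpos.2 hα)

theorem integrable_exp_mul_one_add_mul_I_cpow (hβ : 1 < β) :
    Integrable fun y : ℝ => cexp (1 + y * I) * (1 + y * I) ^ (-β : ℂ) :=
  (integrable_one_add_mul_I_cpow hβ).bdd_mul
    (by fun_prop : Continuous fun y : ℝ => cexp (1 + y * I)).aestronglyMeasurable
    (ae_of_all _ fun y => le_of_eq (by simp [norm_exp] : ‖cexp (1 + y * I)‖ = Real.exp 1))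

theorem bromwichIntegral_eq_of_norm_lt_one (hα : 0 < α) (hβ : 1 < β) {z : ℂ} (hz : ‖z‖ < 1) :
    bromwichIntegral α β z = 2 * Real.pi * mittagLeffler α β z := by
  refine (hasSum_integral_mul_pow (integrable_exp_mul_one_add_mul_I_cpow hβ)
    (continuous_one_add_mul_I_cpow _).aestronglyMeasurable
    (norm_one_add_mul_I_cpow_neg_le_one hα.le) hz).unique ?_
  refine ((hasSum_mittagLeffler hα (one_pos.trans hβ) z).mul_left _).congr_fun fun n => ?_
  have hs : 1 < α * n + β := lt_add_of_nonneg_of_lt (by positivity) hβ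
  have hpow (y : ℝ) : (1 + y * I : ℂ) ^ (-β : ℂ) * ((1 + y * I) ^ (-α : ℂ)) ^ n =
      (1 + y * I) ^ (-(α * n + β : ℝ) : ℂ) := by
    rw [← cpow_mul_nat, one_add_mul_I_cpow_mul_cpow]
    push_cast
    ring_nf
  simp only [mul_assoc, hpow]
  rw [integral_exp_mul_one_add_mul_I_cpow hs]
  ring

end MittagLeffler

section NegCone

/-- The open convex cone around the negative real axis of half-opening angle `arctan ε`. -/
def negCone (ε : ℝ) : Set ℂ := {z | |z.im| < ε * -z.re}

variable {ε κ : ℝ} {z : ℂ}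

theorem isOpen_negCone (ε : ℝ) : IsOpen (negCone ε) := isOpen_lt (by fun_prop) (by fun_prop)

theorem convex_negCone (ε : ℝ) : Convex ℝ (negCone ε) := by
  intro x hx y hy a b ha hb hab
  simp only [negCone, mem_ofPred_eq, add_im, add_re, smul_im, smul_re, smul_eq_mul, abs_lt] at *
  rcases ha.eq_or_lt with rfl | ha
  · obtain rfl : b = 1 := by linarith
    constructor <;> linarith
  · constructor <;> nlinarith

theorem re_neg_of_mem_negCone (hε : 0 < ε) (hz : z ∈ negCone ε) : z.re < 0 :=
  neg_pos.1 (pos_of_mul_pos_right ((abs_nonneg _).trans_lt hz) hε.le)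

theorem negCone_mono {ε' : ℝ} (hε : 0 < ε) (h : ε ≤ ε') : negCone ε ⊆ negCone ε' := fun _ hz =>
  lt_of_lt_of_le hz (mul_le_mul_of_nonneg_right h (neg_nonneg.2 (re_neg_of_mem_negCone hε hz).le))

theorem neg_ofReal_mem_negCone (hε : 0 < ε) {s : ℝ} (hs : 0 < s) : -(s : ℂ) ∈ negCone ε := by
  simp [negCone, hε, hs]

theorem norm_le_of_mem_negCone (hε : 0 < ε) (hz : z ∈ negCone ε) : ‖z‖ ≤ (1 + ε) * -z.re := by
  have hre := re_neg_of_mem_negCone hε hz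
  have hnorm := norm_le_abs_re_add_abs_im z
  rw [abs_of_neg hre] at hnorm
  have him : |z.im| < ε * -z.re := hz
  linarith

theorem closedBall_subset_negCone (hε : 0 < ε) (hz : z ∈ negCone (ε / 2)) :
    Metric.closedBall z (ε / (2 * (1 + ε) ^ 2) * ‖z‖) ⊆ negCone ε := by
  intro w hw
  rw [mem_closedBall_iff_norm] at hw
  have hdist : (1 + ε) * ‖w - z‖ ≤ ε / 2 * -z.re := calc
    (1 + ε) * ‖w - z‖ ≤ (1 + ε) * (ε / (2 * (1 + ε) ^ 2) * ((1 + ε) * -z.re)) := by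
        gcongr
        exact hw.trans (by
          gcongr
          exact norm_le_of_mem_negCone hε (negCone_mono (half_pos hε) (half_le_self hε.le) hz))
    _ = ε / 2 * -z.re := by field_simp
  have him : |w.im| ≤ |z.im| + ‖w - z‖ := by
    have := abs_im_le_norm (w - z)
    rw [sub_im] at this
    linarith [abs_sub_abs_le_abs_sub w.im z.im]
  have hre : -z.re - ‖w - z‖ ≤ -w.re := by
    have := re_le_norm (w - z)
    rw [sub_re] at this
    linarith
  have hz : |z.im| < ε / 2 * -z.re := hz
  have hw : ε * (-z.re - ‖w - z‖) ≤ ε * -w.re := by gcongr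
  exact lt_of_le_of_lt him (by linarith)

theorem re_mul_le_of_mem_negCone (hε : 0 < ε) (hκ : κ ≤ ε) (hz : z ∈ negCone ε) {q : ℂ}
    (hq : κ * ‖q‖ ≤ q.re) : (z * q).re ≤ (ε - κ) * ‖z * q‖ := by
  have hre : 0 < -z.re := neg_pos.2 (re_neg_of_mem_negCone hε hz)
  have him : -(z.im * q.im) ≤ ε * -z.re * ‖q‖ := calc
    -(z.im * q.im) ≤ |z.im| * |q.im| := by rw [← abs_mul]; exact neg_le_abs _
    _ ≤ ε * -z.re * ‖q‖ := by gcongr; exacts [le_of_lt hz, abs_im_le_norm q]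
  calc (z * q).re = -(-z.re * q.re) + -(z.im * q.im) := by rw [mul_re]; ring
    _ ≤ -(-z.re * (κ * ‖q‖)) + ε * -z.re * ‖q‖ := by gcongr
    _ = (ε - κ) * (-z.re * ‖q‖) := by ring
    _ ≤ (ε - κ) * (‖z‖ * ‖q‖) := by
        gcongr
        exact (neg_le_abs _).trans (abs_re_le_norm z)
    _ = (ε - κ) * ‖z * q‖ := by rw [norm_mul]

theorem sqrt_mul_one_add_norm_le_norm_one_sub (hκ : -1 ≤ κ) (hκ₁ : κ ≤ 1) {w : ℂ}
    (hw : w.re ≤ κ * ‖w‖) : √((1 - κ) / 2) * (1 + ‖w‖) ≤ ‖1 - w‖ := by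
  have hsq : ‖1 - w‖ ^ 2 = 1 - 2 * w.re + ‖w‖ ^ 2 := by
    rw [← normSq_eq_norm_sq, ← normSq_eq_norm_sq, normSq_sub]
    simp only [map_one, one_mul, conj_re]
    ring
  refine le_of_sq_le_sq ?_ (norm_nonneg _)
  rw [mul_pow, Real.sq_sqrt (by linarith), hsq]
  nlinarith [mul_nonneg (neg_le_iff_add_nonneg.1 hκ) (sq_nonneg (1 - ‖w‖))]

theorem cos_mul_norm_le_re_one_add_mul_I_cpow_neg {α : ℝ} (hα : 0 ≤ α) (hα₂ : α ≤ 2) (y : ℝ) :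
    Real.cos (α * (Real.pi / 2)) * ‖(1 + y * I : ℂ) ^ (-α : ℂ)‖ ≤
      ((1 + y * I : ℂ) ^ (-α : ℂ)).re := by
  have harg : |α * arg (1 + y * I)| ≤ α * (Real.pi / 2) := by
    rw [abs_mul, abs_of_nonneg hα]
    gcongr
    exact abs_arg_le_pi_div_two_iff.2 (by simp)
  have hpolar : ((1 + y * I : ℂ) ^ (-α : ℂ)).re =
      Real.cos (α * arg (1 + y * I)) * ‖(1 + y * I : ℂ) ^ (-α : ℂ)‖ := by
    rw [cpow_def_of_ne_zero (slitPlane_ne_zero (one_add_mul_I_mem_slitPlane y)), exp_re, norm_exp]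
    simp [mul_comm, log_im]
  rw [hpolar, ← Real.cos_abs (α * arg _)]
  gcongr
  exact Real.cos_le_cos_of_nonneg_of_le_pi (abs_nonneg _) (by nlinarith [Real.pi_pos]) harg

theorem exists_negCone_le_norm_one_sub {α : ℝ} (hα : 0 ≤ α) (hα₂ : α < 2) :
    ∃ ε > 0, ∃ c > 0, ∀ z ∈ negCone ε, ∀ y : ℝ,
      c * (1 + ‖z * (1 + y * I : ℂ) ^ (-α : ℂ)‖) ≤ ‖1 - z * (1 + y * I : ℂ) ^ (-α : ℂ)‖ := by
  set κ := Real.cos (α * (Real.pi / 2))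
  have hκ : -1 < κ := by
    rw [← Real.cos_pi]
    exact Real.cos_lt_cos_of_nonneg_of_le_pi (by positivity) le_rfl (by nlinarith [Real.pi_pos])
  have hκ₁ : κ ≤ 1 := Real.cos_le_one _
  refine ⟨(1 + κ) / 2, by linarith, √((1 - ((1 + κ) / 2 - κ)) / 2),
    Real.sqrt_pos.2 (by linarith), fun z hz y => ?_⟩
  exact sqrt_mul_one_add_norm_le_norm_one_sub (by linarith) (by linarith)
    (re_mul_le_of_mem_negCone (by linarith) (by linarith) hz
      (cos_mul_norm_le_re_one_add_mul_I_cpow_neg hα hα₂.le y))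

end NegCone

section ConicDecay

/-- `f(z) = O(1 / (1 + |z|))` on some cone around the negative real axis. Allowing the cone to
shrink makes the notion stable under `f ↦ z^j f^(j)`, by Cauchy's estimates. -/
def HasConicDecay (f : ℂ → ℂ) : Prop :=
  ∃ ε > 0, f =O[𝓟 (negCone ε)] fun z => (1 + ‖z‖)⁻¹

theorem iteratedDeriv_comp_ofReal {f : ℂ → ℂ} (hf : Differentiable ℂ f) (n : ℕ) :
    iteratedDeriv n (fun s : ℝ => f s) = fun s : ℝ => iteratedDeriv n f s := by
  induction n with
  | zero => simp only [iteratedDeriv_zero]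
  | succ n ih =>
    funext s
    rw [iteratedDeriv_succ, ih, iteratedDeriv_succ]
    exact (hf.contDiff.differentiable_iteratedDeriv' n _).hasDerivAt.comp_ofReal.deriv

theorem inv_one_add_le_rpow {s m : ℝ} (hs : 0 < s) (hm : -1 ≤ m) (hm₀ : m ≤ 0) :
    (1 + s)⁻¹ ≤ s ^ m := by
  rcases le_total s 1 with hs₁ | hs₁
  · exact (inv_le_one_of_one_le₀ (by linarith)).trans
      (Real.one_le_rpow_of_pos_of_le_one_of_nonpos hs hs₁ hm₀)
  · calc (1 + s)⁻¹ ≤ s⁻¹ := by gcongr; linarith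
      _ = s ^ (-1 : ℝ) := (Real.rpow_neg_one s).symm
      _ ≤ s ^ m := Real.rpow_le_rpow_of_exponent_le hs₁ hm

namespace HasConicDecay

variable {f g : ℂ → ℂ}

theorem const_mul (hf : HasConicDecay f) (c : ℂ) : HasConicDecay fun z => c * f z :=
  let ⟨ε, hε, hfO⟩ := hf
  ⟨ε, hε, hfO.const_mul_left c⟩

theorem add (hf : HasConicDecay f) (hg : HasConicDecay g) :
    HasConicDecay fun z => f z + g z := by
  obtain ⟨ε₁, hε₁, hfO⟩ := hf
  obtain ⟨ε₂, hε₂, hgO⟩ := hg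
  have hε : 0 < min ε₁ ε₂ := lt_min hε₁ hε₂
  exact ⟨min ε₁ ε₂, hε,
    (hfO.mono (principal_mono.2 (negCone_mono hε (min_le_left _ _)))).add
      (hgO.mono (principal_mono.2 (negCone_mono hε (min_le_right _ _))))⟩

theorem pow_mul_iteratedDeriv (hf : HasConicDecay f) (hd : Differentiable ℂ f) (j : ℕ) :
    HasConicDecay fun z => z ^ j * iteratedDeriv j f z := by
  obtain ⟨ε, hε, hfO⟩ := hf
  obtain ⟨C, hC, hfC⟩ := hfO.exists_nonneg
  set ρ := ε / (2 * (1 + ε) ^ 2) with hρ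
  have hρ_pos : 0 < ρ := by positivity
  have hρ_le : ρ ≤ 1 / 2 := by
    rw [hρ, div_le_iff₀ (by positivity)]
    nlinarith
  refine ⟨ε / 2, half_pos hε, Asymptotics.isBigO_principal.2
    ⟨j.factorial * (2 * C) / ρ ^ j, fun z hz => ?_⟩⟩
  have hz_pos : 0 < ‖z‖ := norm_pos_iff.2 fun h =>
    (re_neg_of_mem_negCone (half_pos hε) hz).ne (by simp [h])
  have hsphere : ∀ w ∈ Metric.sphere z (ρ * ‖z‖), ‖f w‖ ≤ 2 * C / (1 + ‖z‖) := by
    intro w hw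
    have hwz : ‖z‖ ≤ 2 * ‖w‖ := by
      have := norm_sub_norm_le z w
      rw [norm_sub_rev, mem_sphere_iff_norm.1 hw] at this
      nlinarith
    have hfw := Asymptotics.isBigOWith_principal.1 hfC w
      (closedBall_subset_negCone hε hz (Metric.sphere_subset_closedBall hw))
    rw [Real.norm_of_nonneg (by positivity), ← div_eq_mul_inv] at hfw
    refine hfw.trans ?_
    rw [div_le_div_iff₀ (by positivity) (by positivity)]
    nlinarith
  have hcauchy := norm_iteratedDeriv_le_of_forall_mem_sphere_norm_le j
    (by positivity : 0 < ρ * ‖z‖) hd.diffContOnCl hsphere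
  rw [Real.norm_of_nonneg (by positivity), norm_mul, norm_pow]
  calc ‖z‖ ^ j * ‖iteratedDeriv j f z‖
      ≤ ‖z‖ ^ j * (j.factorial * (2 * C / (1 + ‖z‖)) / (ρ * ‖z‖) ^ j) := by gcongr
    _ = j.factorial * (2 * C) / ρ ^ j * (1 + ‖z‖)⁻¹ := by rw [mul_pow]; field_simp

theorem exists_norm_neg_ofReal_le (hf : HasConicDecay f) :
    ∃ C ≥ 0, ∀ s : ℝ, 0 < s → ‖f (-s)‖ ≤ C * (1 + s)⁻¹ := by
  obtain ⟨ε, hε, hfO⟩ := hf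
  obtain ⟨C, hC, hfC⟩ := hfO.exists_nonneg
  refine ⟨C, hC, fun s hs => ?_⟩
  simpa [abs_of_pos hs, abs_of_pos (by positivity : 0 < 1 + s)] using
    Asymptotics.isBigOWith_principal.1 hfC _ (neg_ofReal_mem_negCone hε hs)

theorem exists_pow_mul_norm_iteratedDeriv_comp_neg_ofReal_le (hf : HasConicDecay f)
    (hd : Differentiable ℂ f) {m : ℝ} (hm : -1 ≤ m) (hm₀ : m ≤ 0) (i : ℕ) :
    ∃ C, ∀ s : ℝ, 0 < s → s ^ i * ‖iteratedDeriv i (fun t : ℝ => f (-t)) s‖ ≤ C * s ^ m := by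
  obtain ⟨C, hC, hbound⟩ := (hf.pow_mul_iteratedDeriv hd i).exists_norm_neg_ofReal_le
  refine ⟨C, fun s hs => ?_⟩
  have hiter : ‖iteratedDeriv i (fun t : ℝ => f (-t)) s‖ = ‖iteratedDeriv i f (-s)‖ := by
    have h := iteratedDeriv_comp_neg i (fun t : ℝ => f t) s
    simp only [ofReal_neg, iteratedDeriv_comp_ofReal hd] at h
    simp [h]
  calc s ^ i * ‖iteratedDeriv i (fun t : ℝ => f (-t)) s‖
      = ‖(-s : ℂ) ^ i * iteratedDeriv i f (-s)‖ := by simp [hiter, abs_of_pos hs]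
    _ ≤ C * (1 + s)⁻¹ := hbound s hs
    _ ≤ C * s ^ m := by gcongr; exact inv_one_add_le_rpow hs hm hm₀

end HasConicDecay

variable {α β : ℝ}

theorem eqOn_negCone_bromwichIntegral (hα : 0 < α) (hβ : 1 < β) {ε c : ℝ} (hε : 0 < ε)
    (hc : 0 < c) (hsep : ∀ z ∈ negCone ε, ∀ y : ℝ, c ≤ ‖1 - z * (1 + y * I : ℂ) ^ (-α : ℂ)‖) :
    EqOn (bromwichIntegral α β) (fun z => 2 * Real.pi * mittagLeffler α β z) (negCone ε) := by
  have hintegral : AnalyticOnNhd ℂ (bromwichIntegral α β) (negCone ε) :=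
    (differentiableOn_integral_div_one_sub_mul (integrable_exp_mul_one_add_mul_I_cpow hβ)
      (continuous_one_add_mul_I_cpow _).aestronglyMeasurable
      (norm_one_add_mul_I_cpow_neg_le_one hα.le) (isOpen_negCone ε) hc hsep).analyticOnNhd
      (isOpen_negCone ε)
  have hseries : AnalyticOnNhd ℂ (fun z => 2 * Real.pi * mittagLeffler α β z) (negCone ε) :=
    ((differentiable_mittagLeffler hα (one_pos.trans hβ)).const_mul
      _).differentiableOn.analyticOnNhd (isOpen_negCone ε)
  refine hintegral.eqOn_of_preconnected_of_eventuallyEq hseries (convex_negCone ε).isPreconnected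
    (neg_ofReal_mem_negCone hε (one_half_pos (α := ℝ))) ?_
  filter_upwards [(isOpen_lt continuous_norm continuous_const).mem_nhds
    (by norm_num : ‖-((1 / 2 : ℝ) : ℂ)‖ < 1)] with z hz
  exact bromwichIntegral_eq_of_norm_lt_one hα hβ hz

theorem hasConicDecay_mittagLeffler_of_add_one_lt (hα : 0 < α) (hα₂ : α < 2) (hβ : α + 1 < β) :
    HasConicDecay (mittagLeffler α β) := by
  obtain ⟨ε, hε, c, hc, hsep⟩ := exists_negCone_le_norm_one_sub hα.le hα₂
  have hquot (y : ℝ) : cexp (1 + y * I) * (1 + y * I) ^ (-(β - α : ℝ) : ℂ) =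
      cexp (1 + y * I) * (1 + y * I) ^ (-β : ℂ) / (1 + y * I) ^ (-α : ℂ) := by
    rw [eq_div_iff (one_add_mul_I_cpow_ne_zero y _), mul_assoc, one_add_mul_I_cpow_mul_cpow]
    push_cast
    ring_nf
  have hintegrable := (integrable_exp_mul_one_add_mul_I_cpow (lt_sub_iff_add_lt'.2 hβ)).congr
    (ae_of_all _ hquot)
  obtain ⟨C, hbound⟩ : ∃ C, ∀ z ∈ negCone ε, ‖bromwichIntegral α β z‖ ≤ C * (1 + ‖z‖)⁻¹ :=
    ⟨_, fun z hz => norm_integral_div_one_sub_mul_le hintegrable (one_add_mul_I_cpow_ne_zero · _)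
      (norm_one_add_mul_I_cpow_neg_le_one hα.le) hc (hsep z hz)⟩
  have heq : EqOn (bromwichIntegral α β) (fun z => 2 * Real.pi * mittagLeffler α β z) (negCone ε) :=
    eqOn_negCone_bromwichIntegral hα (by linarith) hε hc fun z hz y =>
      (le_mul_of_one_le_right hc.le (le_add_of_nonneg_right (norm_nonneg _))).trans (hsep z hz y)
  have hdecay : HasConicDecay fun z => 2 * Real.pi * mittagLeffler α β z := by
    refine ⟨ε, hε, Asymptotics.isBigO_principal.2 ⟨C, fun z hz => ?_⟩⟩
    have hz' : bromwichIntegral α β z = 2 * Real.pi * mittagLeffler α β z := heq hz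
    rw [← hz', Real.norm_of_nonneg (by positivity)]
    exact hbound z hz
  convert! hdecay.const_mul (2 * Real.pi)⁻¹ using 2 with z
  field_simp

theorem hasConicDecay_mittagLeffler (hα : 0 < α) (hα₂ : α < 2) (hβ : 0 < β) :
    HasConicDecay (mittagLeffler α β) := by
  obtain ⟨m, hm⟩ := exists_nat_gt (α + 1 - β)
  induction m generalizing β with
  | zero => exact hasConicDecay_mittagLeffler_of_add_one_lt hα hα₂ (by simpa using hm)
  | succ m ih =>
    have hβ₁ : 0 < β + 1 := by positivity
    have hdecay : HasConicDecay (mittagLeffler α (β + 1)) := ih hβ₁ (by push_cast at hm; linarith)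
    have hderiv := hdecay.pow_mul_iteratedDeriv (differentiable_mittagLeffler hα hβ₁) 1
    simp only [pow_one, iteratedDeriv_one] at hderiv
    rw [funext (mittagLeffler_eq_add_mul_deriv hα hβ)]
    exact (hdecay.const_mul β).add (hderiv.const_mul α)

end ConicDecay

section Symbol

variable {E F : Type*} [NormedAddCommGroup E] [NormedSpace ℝ E] [NormedAddCommGroup F]
  [NormedSpace ℝ F]

/-- A homogeneous Mikhlin-type symbol of order `m`: a smooth function on the punctured space whose
`n`-th derivative is `O(‖ξ‖ ^ (m - n))`, uniformly both near the origin and near infinity. -/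
structure IsSymbol (m : ℝ) (f : E → F) : Prop where
  contDiffOn : ContDiffOn ℝ ∞ f {0}ᶜ
  exists_norm_le (n : ℕ) : ∃ C, ∀ ξ ≠ 0, ‖iteratedFDeriv ℝ n f ξ‖ ≤ C * ‖ξ‖ ^ (m - n)

theorem exists_one_le_forall_le (C : ℕ → ℝ) (n : ℕ) : ∃ M ≥ 1, ∀ i ≤ n, C i ≤ M := by
  obtain ⟨M, hM⟩ := ((finite_Iic n).image C).bddAbove
  exact ⟨max M 1, le_max_right _ _, fun i hi =>
    (hM (mem_image_of_mem C hi)).trans (le_max_left _ _)⟩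

theorem IsSymbol.exists_forall_norm_le {m : ℝ} {f : E → F} (hf : IsSymbol m f) (n : ℕ) :
    ∃ C ≥ 1, ∀ i ≤ n, ∀ ξ ≠ 0, ‖iteratedFDeriv ℝ i f ξ‖ ≤ C * ‖ξ‖ ^ (m - i) := by
  choose C hC using hf.exists_norm_le
  obtain ⟨M, hM, hCM⟩ := exists_one_le_forall_le C n
  exact ⟨M, hM, fun i hi ξ hξ => (hC i ξ hξ).trans (by gcongr; exact hCM i hi)⟩

theorem iteratedFDeriv_comp_smul {c : ℝ} (hc : c ≠ 0) (f : E → F) (n : ℕ) (x : E) :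
    iteratedFDeriv ℝ n (fun y => f (c • y)) x = c ^ n • iteratedFDeriv ℝ n f (c • x) := by
  have h := (ContinuousLinearEquiv.smulLeft (R₁ := ℝ) (M₁ := E)
    (Units.mk0 c hc)).iteratedFDerivWithin_comp_right f uniqueDiffOn_univ (mem_univ _) n (x := x)
  simp only [preimage_univ, iteratedFDerivWithin_univ] at h
  refine h.trans ?_
  ext v
  simp [Units.smul_def, ContinuousMultilinearMap.map_smul_univ]

section Homogeneous

variable {m : ℝ} {f : E → F}

theorem eq_rpow_smul_of_homogeneous
    (hhom : ∀ t : ℝ, 0 < t → ∀ ξ, ξ ≠ 0 → f (t • ξ) = t ^ m • f ξ) {r : ℝ} (hr : 0 < r) {ξ : E}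
    (hξ : ξ ≠ 0) : f ξ = r ^ m • f (r⁻¹ • ξ) := by
  rw [← hhom r hr _ (smul_ne_zero (inv_ne_zero hr.ne') hξ), smul_inv_smul₀ hr.ne']

theorem iteratedFDeriv_smul_of_homogeneous (hf : ContDiffOn ℝ ∞ f {0}ᶜ)
    (hhom : ∀ t : ℝ, 0 < t → ∀ ξ, ξ ≠ 0 → f (t • ξ) = t ^ m • f ξ) (n : ℕ) {t : ℝ} (ht : 0 < t)
    {ξ : E} (hξ : ξ ≠ 0) :
    iteratedFDeriv ℝ n f (t • ξ) = t ^ (m - n) • iteratedFDeriv ℝ n f ξ := by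
  have hnhds : {0}ᶜ ∈ 𝓝 ξ := isOpen_compl_singleton.mem_nhds hξ
  have heq : (fun η => f (t • η)) =ᶠ[𝓝 ξ] fun η => t ^ m • f η := by
    filter_upwards [hnhds] with η hη using hhom t ht η hη
  have hderiv := (heq.iteratedFDeriv ℝ n).eq_of_nhds
  rw [iteratedFDeriv_comp_smul ht.ne', iteratedFDeriv_const_smul_apply'
    ((hf.contDiffAt hnhds).of_le (mod_cast le_top))] at hderiv
  rw [Real.rpow_sub_natCast ht.ne', div_eq_inv_mul, mul_smul, ← hderiv,
    inv_smul_smul₀ (pow_ne_zero n ht.ne')]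

theorem isSymbol_of_homogeneous [FiniteDimensional ℝ E] (hf : ContDiffOn ℝ ∞ f {0}ᶜ)
    (hhom : ∀ t : ℝ, 0 < t → ∀ ξ, ξ ≠ 0 → f (t • ξ) = t ^ m • f ξ) : IsSymbol m f := by
  refine ⟨hf, fun n => ?_⟩
  have hcont : ContinuousOn (iteratedFDeriv ℝ n f) (Metric.sphere 0 1) :=
    ((hf.continuousOn_iteratedFDerivWithin (mod_cast le_top)
      isOpen_compl_singleton.uniqueDiffOn).congr fun x hx =>
        (iteratedFDerivWithin_of_isOpen n isOpen_compl_singleton hx).symm).mono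
          fun x hx => ne_zero_of_mem_unit_sphere ⟨x, hx⟩
  obtain ⟨C, hC⟩ := (isCompact_sphere 0 1).exists_bound_of_continuousOn hcont
  refine ⟨C, fun ξ hξ => ?_⟩
  rw [eq_rpow_smul_of_homogeneous (f := iteratedFDeriv ℝ n f) (m := m - n)
    (fun t ht η hη => iteratedFDeriv_smul_of_homogeneous hf hhom n ht hη) (norm_pos_iff.2 hξ) hξ,
    norm_smul, Real.norm_of_nonneg (by positivity), mul_comm]
  gcongr
  exact hC _ (by simp [norm_smul, hξ])

theorem exists_mul_rpow_norm_le_of_homogeneous [FiniteDimensional ℝ E] {σ : E → ℝ}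
    (hσ : ContinuousOn σ {0}ᶜ) (hpos : ∀ ξ, ξ ≠ 0 → 0 < σ ξ)
    (hhom : ∀ t : ℝ, 0 < t → ∀ ξ, ξ ≠ 0 → σ (t • ξ) = t ^ m * σ ξ) :
    ∃ a > 0, ∀ ξ ≠ 0, a * ‖ξ‖ ^ m ≤ σ ξ := by
  have hsphere : ∀ x ∈ Metric.sphere (0 : E) 1, x ≠ 0 :=
    fun x hx => ne_zero_of_mem_unit_sphere ⟨x, hx⟩
  obtain ⟨a, ha, hle⟩ := (isCompact_sphere (0 : E) 1).exists_forall_le' (hσ.mono hsphere)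
    fun x hx => hpos x (hsphere x hx)
  refine ⟨a, ha, fun ξ hξ => ?_⟩
  rw [eq_rpow_smul_of_homogeneous hhom (norm_pos_iff.2 hξ) hξ, smul_eq_mul, mul_comm]
  gcongr
  exact hle _ (by simp [norm_smul, hξ])

end Homogeneous

theorem isSymbol_norm_rpow {V : Type*} [NormedAddCommGroup V] [InnerProductSpace ℝ V]
    [FiniteDimensional ℝ V] (δ : ℝ) : IsSymbol δ fun ξ : V => ((‖ξ‖ ^ δ : ℝ) : ℂ) := by
  refine isSymbol_of_homogeneous (fun ξ hξ => ContDiffAt.contDiffWithinAt ?_) fun t ht ξ _ => ?_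
  · exact ofRealCLM.contDiff.contDiffAt.comp ξ
      ((contDiffAt_norm ℝ hξ).rpow_const_of_ne (norm_ne_zero_iff.2 hξ))
  · rw [norm_smul, Real.norm_of_nonneg ht.le, Real.mul_rpow ht.le (norm_nonneg ξ), ofReal_mul,
      real_smul]

/-- Both factors of `g ∘ σ` are normalised at the point `ξ`, as `g (s ·)` and `s⁻¹ σ` with
`s = σ ξ`, so that the Faà di Bruno bound becomes scale invariant. -/
theorem norm_iteratedFDeriv_comp_le_of_normalized {σ : E → ℝ} {g : ℝ → F}
    (hg : ContDiffOn ℝ ∞ g (Ioi 0)) {U : Set E} (hU : IsOpen U) (hσ : ContDiffOn ℝ ∞ σ U)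
    (hpos : ∀ η ∈ U, 0 < σ η) {ξ : E} (hξ : ξ ∈ U) {n : ℕ} {C D : ℝ}
    (hC : ∀ i ≤ n, σ ξ ^ i * ‖iteratedDeriv i g (σ ξ)‖ ≤ C)
    (hD : ∀ i, 1 ≤ i → i ≤ n → ‖iteratedFDeriv ℝ i σ ξ‖ ≤ σ ξ * D ^ i) :
    ‖iteratedFDeriv ℝ n (g ∘ σ) ξ‖ ≤ n.factorial * C * D ^ n := by
  set s := σ ξ with hs_def
  have hs : 0 < s := hpos ξ hξ
  have hcomp : g ∘ σ = (fun t => g (s • t)) ∘ (fun η => s⁻¹ • σ η) := by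
    funext η
    simp [hs.ne']
  have hone : s⁻¹ • σ ξ = 1 := by simp [← hs_def, hs.ne']
  have hG : ContDiffOn ℝ ∞ (fun t => g (s • t)) (Ioi 0) :=
    hg.comp (contDiff_const_smul s).contDiffOn fun t ht => mul_pos hs ht
  have hmaps : MapsTo (fun η => s⁻¹ • σ η) U (Ioi 0) := fun η hη =>
    mul_pos (inv_pos.2 hs) (hpos η hη)
  rw [hcomp, ← iteratedFDerivWithin_of_isOpen n hU hξ]
  refine norm_iteratedFDerivWithin_comp_le hG (hσ.const_smul s⁻¹) (mod_cast le_top)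
    isOpen_Ioi.uniqueDiffOn hU.uniqueDiffOn hmaps hξ (fun i hi => ?_)
    fun i hi₁ hi => ?_
  · rw [hone, iteratedFDerivWithin_of_isOpen i isOpen_Ioi (mem_Ioi.2 one_pos),
      iteratedFDeriv_comp_smul hs.ne', norm_smul, norm_pow, Real.norm_of_nonneg hs.le, smul_eq_mul,
      mul_one, norm_iteratedFDeriv_eq_norm_iteratedDeriv]
    exact hC i hi
  · have hσi : ContDiffAt ℝ i σ ξ :=
      (hσ.contDiffAt (hU.mem_nhds hξ)).of_le (mod_cast le_top)
    rw [iteratedFDerivWithin_of_isOpen i hU hξ,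
      iteratedFDeriv_const_smul_apply' hσi, norm_smul, norm_inv, Real.norm_of_nonneg hs.le,
      inv_mul_le_iff₀ hs]
    exact hD i hi₁ hi

namespace IsSymbol

theorem mul {A : Type*} [NormedRing A] [NormedAlgebra ℝ A] {m₁ m₂ : ℝ} {f g : E → A}
    (hf : IsSymbol m₁ f) (hg : IsSymbol m₂ g) : IsSymbol (m₁ + m₂) fun ξ => f ξ * g ξ := by
  refine ⟨hf.contDiffOn.mul hg.contDiffOn, fun n => ?_⟩
  choose C hC using hf.exists_norm_le
  choose D hD using hg.exists_norm_le
  refine ⟨∑ i ∈ Finset.range (n + 1), n.choose i * C i * D (n - i), fun ξ hξ => ?_⟩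
  have hleibniz := norm_iteratedFDerivWithin_mul_le hf.contDiffOn hg.contDiffOn
    isOpen_compl_singleton.uniqueDiffOn (x := ξ) hξ (n := n) (mod_cast le_top)
  simp only [iteratedFDerivWithin_of_isOpen _ isOpen_compl_singleton (mem_compl_singleton_iff.2 hξ)]
    at hleibniz
  rw [Finset.sum_mul]
  refine hleibniz.trans (Finset.sum_le_sum fun i hi => ?_)
  have hin : i ≤ n := Finset.mem_range_succ_iff.1 hi
  have hexp : m₁ + m₂ - n = (m₁ - i) + (m₂ - (n - i : ℕ)) := by
    push_cast [hin]
    ring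
  calc n.choose i * ‖iteratedFDeriv ℝ i f ξ‖ * ‖iteratedFDeriv ℝ (n - i) g ξ‖
      ≤ n.choose i * (C i * ‖ξ‖ ^ (m₁ - i)) * (D (n - i) * ‖ξ‖ ^ (m₂ - (n - i : ℕ))) := by
        have := (norm_nonneg _).trans (hC i ξ hξ)
        gcongr
        · exact hC i ξ hξ
        · exact hD (n - i) ξ hξ
    _ = n.choose i * C i * D (n - i) * ‖ξ‖ ^ (m₁ + m₂ - n) := by
        rw [hexp, Real.rpow_add (norm_pos_iff.2 hξ)]
        ring

theorem comp {σ : E → ℝ} {g : ℝ → F} {a k m : ℝ} (hσ : IsSymbol k σ) (ha : 0 < a)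
    (hlow : ∀ ξ ≠ 0, a * ‖ξ‖ ^ k ≤ σ ξ) (hg : ContDiffOn ℝ ∞ g (Ioi 0)) (hm : m ≤ 0)
    (hgm : ∀ i : ℕ, ∃ C, ∀ s : ℝ, 0 < s → s ^ i * ‖iteratedDeriv i g s‖ ≤ C * s ^ m) :
    IsSymbol (k * m) (g ∘ σ) := by
  have hnorm : ∀ ξ : E, ξ ≠ 0 → 0 < a * ‖ξ‖ ^ k := fun ξ hξ => by
    have := norm_pos_iff.2 hξ
    positivity
  have hpos : ∀ ξ, ξ ≠ 0 → 0 < σ ξ := fun ξ hξ => (hnorm ξ hξ).trans_le (hlow ξ hξ)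
  refine ⟨hg.comp hσ.contDiffOn hpos, fun n => ?_⟩
  choose C hC using hgm
  obtain ⟨M, hM, hCM⟩ := exists_one_le_forall_le C n
  obtain ⟨B, hB, hσB⟩ := hσ.exists_forall_norm_le n
  set D := max (B / a) 1
  refine ⟨n.factorial * (M * a ^ m) * D ^ n, fun ξ hξ => ?_⟩
  have hξ₀ : 0 < ‖ξ‖ := norm_pos_iff.2 hξ
  have hrpow : σ ξ ^ m ≤ a ^ m * ‖ξ‖ ^ (k * m) := by
    rw [Real.rpow_mul hξ₀.le, ← Real.mul_rpow ha.le (by positivity)]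
    exact Real.rpow_le_rpow_of_nonpos (hnorm ξ hξ) (hlow ξ hξ) hm
  have hbound := norm_iteratedFDeriv_comp_le_of_normalized hg isOpen_compl_singleton
    hσ.contDiffOn hpos hξ (n := n) (C := M * (a ^ m * ‖ξ‖ ^ (k * m))) (D := D / ‖ξ‖)
    (fun i hi => (hC i _ (hpos ξ hξ)).trans (by
      have := hpos ξ hξ
      gcongr
      exact hCM i hi))
    fun i hi₁ hi => ?_
  · refine hbound.trans_eq ?_
    rw [Real.rpow_sub_natCast hξ₀.ne', div_pow]
    ring
  · calc ‖iteratedFDeriv ℝ i σ ξ‖ ≤ B * ‖ξ‖ ^ (k - i) := hσB i hi ξ hξ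
      _ = a * ‖ξ‖ ^ k * (B / a) / ‖ξ‖ ^ i := by
        rw [Real.rpow_sub_natCast hξ₀.ne']
        field_simp
      _ ≤ σ ξ * D ^ i / ‖ξ‖ ^ i := by
        have hD₁ : B / a ≤ D ^ i :=
          (le_max_left _ _).trans (le_self_pow₀ (le_max_right _ _) (by lia))
        have := hpos ξ hξ
        gcongr
        exact hlow ξ hξ
      _ = σ ξ * (D / ‖ξ‖) ^ i := by rw [div_pow, mul_div_assoc]

end IsSymbol

theorem isSymbol_norm_rpow_mul_mittagLeffler {V : Type*} [NormedAddCommGroup V]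
    [InnerProductSpace ℝ V] [FiniteDimensional ℝ V] {σ : V → ℝ} {k α β δ : ℝ}
    (hσ : ContDiffOn ℝ ∞ σ {0}ᶜ) (hpos : ∀ ξ, ξ ≠ 0 → 0 < σ ξ)
    (hhom : ∀ t : ℝ, 0 < t → ∀ ξ, ξ ≠ 0 → σ (t • ξ) = t ^ k * σ ξ)
    (hα : 0 < α) (hα₂ : α < 2) (hβ : 0 < β) (hδ : 0 ≤ δ) (hδk : δ ≤ k) :
    IsSymbol 0 fun ξ : V => ((‖ξ‖ ^ δ : ℝ) : ℂ) * mittagLeffler α β (-(σ ξ : ℂ)) := by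
  have hentire : Differentiable ℂ (mittagLeffler α β) := differentiable_mittagLeffler hα hβ
  have hprofile : ContDiff ℝ ∞ fun s : ℝ => mittagLeffler α β (-(s : ℂ)) :=
    (hentire.contDiff.restrict_scalars ℝ).comp ofRealCLM.contDiff.neg
  obtain ⟨a, ha, hlow⟩ := exists_mul_rpow_norm_le_of_homogeneous hσ.continuousOn hpos hhom
  have hcomp := (isSymbol_of_homogeneous hσ hhom).comp ha hlow hprofile.contDiffOn
    (neg_nonpos.2 (div_nonneg hδ (hδ.trans hδk)))
    ((hasConicDecay_mittagLeffler hα hα₂ hβ).exists_pow_mul_norm_iteratedDeriv_comp_neg_ofReal_le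
      hentire (neg_le_neg (div_le_one_of_le₀ hδk (hδ.trans hδk)))
        (neg_nonpos.2 (div_nonneg hδ (hδ.trans hδk))))
  have horder : δ + k * -(δ / k) = 0 := by
    rcases eq_or_ne k 0 with rfl | hk
    · simp [le_antisymm hδk hδ]
    · field_simp
      ring
  exact horder ▸ (isSymbol_norm_rpow δ).mul hcomp

end Symbol

section PartialDerivatives

variable {N : ℕ} {F : Type*} [NormedAddCommGroup F] [NormedSpace ℝ F]
  {f : EuclideanSpace ℝ (Fin N) → F} {U : Set (EuclideanSpace ℝ (Fin N))}

theorem partialDeriv_eq_fderiv_apply (hU : IsOpen U) (hf : ContDiffOn ℝ ∞ f U) (i : Fin N) :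
    EqOn (partialDeriv i f) (fun x => fderiv ℝ f x (EuclideanSpace.single i 1)) U := fun _ hx =>
  ((hf.contDiffAt (hU.mem_nhds hx)).differentiableAt (by simp)).lineDeriv_eq_fderiv

theorem contDiffOn_partialDeriv (hU : IsOpen U) (hf : ContDiffOn ℝ ∞ f U) (i : Fin N) :
    ContDiffOn ℝ ∞ (partialDeriv i f) U :=
  ((hf.fderiv_of_isOpen hU (by simp)).clm_apply contDiffOn_const).congr
    (partialDeriv_eq_fderiv_apply hU hf i)

theorem norm_iteratedFDeriv_partialDeriv_le (hU : IsOpen U) (hf : ContDiffOn ℝ ∞ f U) (i : Fin N)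
    (n : ℕ) {x : EuclideanSpace ℝ (Fin N)} (hx : x ∈ U) :
    ‖iteratedFDeriv ℝ n (partialDeriv i f) x‖ ≤ ‖iteratedFDeriv ℝ (n + 1) f x‖ := by
  set evalBasis : (EuclideanSpace ℝ (Fin N) →L[ℝ] F) →L[ℝ] F :=
    ContinuousLinearMap.apply ℝ F (EuclideanSpace.single i (1 : ℝ)) with h_eval
  have heq : partialDeriv i f =ᶠ[𝓝 x] evalBasis ∘ fderiv ℝ f :=
    (partialDeriv_eq_fderiv_apply hU hf i).eventuallyEq_of_mem (hU.mem_nhds hx)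
  have hnorm : ‖evalBasis‖ ≤ 1 := by
    refine ContinuousLinearMap.opNorm_le_bound _ zero_le_one fun g => ?_
    simpa [h_eval] using g.le_opNorm (EuclideanSpace.single i (1 : ℝ))
  have hfderiv : ContDiffAt ℝ ∞ (fderiv ℝ f) x :=
    (hf.contDiffAt (hU.mem_nhds hx)).fderiv_right (by simp)
  rw [(heq.iteratedFDeriv ℝ n).eq_of_nhds, ← norm_iteratedFDeriv_fderiv]
  exact (evalBasis.norm_iteratedFDeriv_comp_left hfderiv (mod_cast le_top)).trans
    (mul_le_of_le_one_left (norm_nonneg _) hnorm)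

theorem contDiffOn_iterate_partialDeriv (hU : IsOpen U) (hf : ContDiffOn ℝ ∞ f U) (i : Fin N)
    (m : ℕ) : ContDiffOn ℝ ∞ ((partialDeriv i)^[m] f) U := by
  induction m with
  | zero => exact hf
  | succ m ih =>
    rw [Function.iterate_succ_apply']
    exact contDiffOn_partialDeriv hU ih i

theorem norm_iteratedFDeriv_iterate_partialDeriv_le (hU : IsOpen U) (hf : ContDiffOn ℝ ∞ f U)
    (i : Fin N) (m n : ℕ) {x : EuclideanSpace ℝ (Fin N)} (hx : x ∈ U) :
    ‖iteratedFDeriv ℝ n ((partialDeriv i)^[m] f) x‖ ≤ ‖iteratedFDeriv ℝ (n + m) f x‖ := by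
  induction m generalizing n with
  | zero => exact le_rfl
  | succ m ih =>
    rw [Function.iterate_succ_apply', ← add_assoc, add_right_comm]
    exact (norm_iteratedFDeriv_partialDeriv_le hU (contDiffOn_iterate_partialDeriv hU hf i m) i n
      hx).trans (ih (n + 1))

theorem contDiffOn_foldr_partialDeriv (hU : IsOpen U) (hf : ContDiffOn ℝ ∞ f U) (γ : Fin N → ℕ)
    (l : List (Fin N)) :
    ContDiffOn ℝ ∞ (l.foldr (fun i g => (partialDeriv i)^[γ i] g) f) U := by
  induction l with
  | nil => exact hf
  | cons i l ih => exact contDiffOn_iterate_partialDeriv hU ih i (γ i)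

theorem norm_iteratedFDeriv_foldr_partialDeriv_le (hU : IsOpen U) (hf : ContDiffOn ℝ ∞ f U)
    (γ : Fin N → ℕ) (l : List (Fin N)) (n : ℕ) {x : EuclideanSpace ℝ (Fin N)} (hx : x ∈ U) :
    ‖iteratedFDeriv ℝ n (l.foldr (fun i g => (partialDeriv i)^[γ i] g) f) x‖ ≤
      ‖iteratedFDeriv ℝ (n + (l.map γ).sum) f x‖ := by
  induction l generalizing n with
  | nil => exact le_rfl
  | cons i l ih =>
    rw [List.foldr_cons, List.map_cons, List.sum_cons, ← add_assoc]
    exact (norm_iteratedFDeriv_iterate_partialDeriv_le hU (contDiffOn_foldr_partialDeriv hU hf γ l)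
      i (γ i) n hx).trans (ih (n + γ i))

theorem norm_multiDeriv_le (hU : IsOpen U) (hf : ContDiffOn ℝ ∞ f U) (γ : Fin N → ℕ)
    {x : EuclideanSpace ℝ (Fin N)} (hx : x ∈ U) :
    ‖multiDeriv γ f x‖ ≤ ‖iteratedFDeriv ℝ (∑ i, γ i) f x‖ := by
  have h := norm_iteratedFDeriv_foldr_partialDeriv_le hU hf γ (List.finRange N) 0 hx
  rwa [norm_iteratedFDeriv_zero, zero_add, ← Fin.sum_univ_def] at h

theorem multiDeriv_zero (f : EuclideanSpace ℝ (Fin N) → F) : multiDeriv 0 f = f := by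
  simp [multiDeriv]

theorem IsSymbol.exists_norm_multiDeriv_le {m : ℝ} (hf : IsSymbol m f) (n : ℕ) :
    ∃ C > 0, ∀ γ : Fin N → ℕ, ∑ i, γ i ≤ n → ∀ ξ, ξ ≠ 0 →
      ‖multiDeriv γ f ξ‖ ≤ C * ‖ξ‖ ^ (m - (∑ i, γ i : ℕ)) := by
  obtain ⟨C, hC, hbound⟩ := hf.exists_forall_norm_le n
  exact ⟨C, one_pos.trans_le hC, fun γ hγ ξ hξ =>
    (norm_multiDeriv_le isOpen_compl_singleton hf.contDiffOn γ hξ).trans (hbound _ hγ ξ hξ)⟩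

end PartialDerivatives

theorem exists_pos_one_le_mul_of_abs_le {E : Type*} [NormedAddCommGroup E] {σ : E → ℝ}
    (hpos : ∀ ξ, ξ ≠ 0 → 0 < σ ξ) (k : ℝ) :
    ∃ c > 0, ∀ A : ℝ, (∀ ξ, ξ ≠ 0 → |σ ξ| ≤ A * ‖ξ‖ ^ k) → ∀ ξ : E, ξ ≠ 0 → 1 ≤ c * A := by
  rcases subsingleton_or_nontrivial E with hE | hE
  · exact ⟨1, one_pos, fun A _ ξ hξ => absurd (Subsingleton.elim ξ 0) hξ⟩
  · obtain ⟨e, he⟩ := exists_ne (0 : E)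
    have hσe := hpos e he
    have : 0 < ‖e‖ := norm_pos_iff.2 he
    refine ⟨‖e‖ ^ k / σ e, by positivity, fun A hA _ _ => ?_⟩
    rw [div_mul_eq_mul_div, one_le_div hσe, mul_comm]
    exact (le_abs_self _).trans (hA e he)

theorem proposition4p2_general (N n : ℕ) {k α β δ : ℝ} {σ : EuclideanSpace ℝ (Fin N) → ℝ}
    (hσ_smooth : ContDiffOn ℝ ∞ σ {0}ᶜ) (hσ_pos : ∀ ξ, ξ ≠ 0 → 0 < σ ξ)
    (hσ_hom : ∀ t : ℝ, 0 < t → ∀ ξ, ξ ≠ 0 → σ (t • ξ) = t ^ k * σ ξ)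
    (hα : 0 < α) (hα₂ : α < 2) (hβ : 0 < β) (hδ : 0 ≤ δ) (hδk : δ ≤ k) :
    ContDiffOn ℝ ∞ (fun ξ : EuclideanSpace ℝ (Fin N) =>
        ((‖ξ‖ ^ δ : ℝ) : ℂ) * mittagLeffler α β (-(σ ξ : ℂ))) {0}ᶜ ∧
    ∃ C : ℝ, 0 < C ∧ ∀ A : ℝ, (∀ ξ, ξ ≠ 0 → |σ ξ| ≤ A * ‖ξ‖ ^ k) →
      ∀ γ : Fin N → ℕ, ∑ i, γ i ≤ n → ∀ ξ, ξ ≠ 0 →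
        ‖multiDeriv γ (fun η : EuclideanSpace ℝ (Fin N) =>
            ((‖η‖ ^ δ : ℝ) : ℂ) * mittagLeffler α β (-(σ η : ℂ))) ξ‖
          ≤ C * A * ‖ξ‖ ^ (-((∑ i, γ i : ℕ) : ℝ)) := by
  have hsymbol := isSymbol_norm_rpow_mul_mittagLeffler hσ_smooth hσ_pos hσ_hom hα hα₂ hβ hδ hδk
  obtain ⟨C, hC, hbound⟩ := hsymbol.exists_norm_multiDeriv_le n
  obtain ⟨c, hc, hA_ge⟩ := exists_pos_one_le_mul_of_abs_le hσ_pos k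
  refine ⟨hsymbol.contDiffOn, C * c, mul_pos hC hc, fun A hA γ hγ ξ hξ => ?_⟩
  refine (hbound γ hγ ξ hξ).trans ?_
  rw [zero_sub, mul_assoc C c A]
  gcongr
  exact le_mul_of_one_le_right hC.le (hA_ge A hA ξ hξ)

theorem proposition4p2 (N : ℕ) (k : ℝ) (hk : 0 < k)
    (σ : EuclideanSpace ℝ (Fin N) → ℝ)
    (hσ_smooth : ContDiffOn ℝ ∞ σ {0}ᶜ)
    (hσ_pos : ∀ ξ, ξ ≠ 0 → 0 < σ ξ)
    (hσ_hom : ∀ t : ℝ, 0 < t → ∀ ξ, ξ ≠ 0 → σ (t • ξ) = t ^ k * σ ξ)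
    (α : ℝ) (hα₁ : 1 < α) (hα₂ : α < 2)
    (δ : ℝ) (hδ₀ : 0 ≤ δ) (hδk : δ < k) :
    ContDiffOn ℝ ∞ (fun ξ : EuclideanSpace ℝ (Fin N) =>
        ((‖ξ‖ ^ δ : ℝ) : ℂ) * mittagLeffler α 1 (-(σ ξ : ℂ))) {0}ᶜ ∧
    ∃ C : ℝ, 0 < C ∧ ∀ A : ℝ,
      (∀ γ : Fin N → ℕ, ∑ i, γ i ≤ N / 2 + 1 → ∀ ξ, ξ ≠ 0 →
        |multiDeriv γ σ ξ| ≤ A * ‖ξ‖ ^ (k - ((∑ i, γ i : ℕ) : ℝ))) →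
      ∀ γ : Fin N → ℕ, ∑ i, γ i ≤ N / 2 + 1 → ∀ ξ, ξ ≠ 0 →
        ‖multiDeriv γ (fun η : EuclideanSpace ℝ (Fin N) =>
            ((‖η‖ ^ δ : ℝ) : ℂ) * mittagLeffler α 1 (-(σ η : ℂ))) ξ‖
          ≤ C * A * ‖ξ‖ ^ (-((∑ i, γ i : ℕ) : ℝ)) := by
  obtain ⟨hsmooth, C, hC, hbound⟩ := proposition4p2_general N (N / 2 + 1) hσ_smooth hσ_pos hσ_hom
    (one_pos.trans hα₁) hα₂ one_pos hδ₀ hδk.le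
  exact ⟨hsmooth, C, hC, fun A hA => hbound A fun ξ hξ => by
    simpa [multiDeriv_zero] using hA 0 (by simp) ξ hξ⟩
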